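/- A parameterization is a function $\kappa:\{0,1\}^*\to\mathbb N$ that is computable in polynomial time and satisfies $\kappa(x)\le |x|$ for all $x$; a parameterized problem is a pair $(X,\kappa)$ with $X\subseteq\{0,1\}^*$ and $\kappa$ a parameterization. A polynomial Turing kernelization for $(X,\kappa)$ is a polynomial-time oracle Turing machine that, with oracle $X$, decides $X$ and on every input $x$ only asks queries of length at most $p(\kappa(x))$, for a fixed polynomial $p$. It is a polynomial truth-table kernelization if, on every input, the queries that it asks do not depend on the answers of the oracle. A psize kernelization is a polynomial truth-table kernelization for which there are a polynomial $q$ and a polynomial-time algorithm that maps each input $x$ to a Boolean circuit $C_x$ with at most $q(\kappa(x))$ gates, such that on every input $x$ the machine asks at most $q(\kappa(x))$ queries and its output is the output of $C_x$ on the sequence of the oracle's answers to these queries. **Theorem.** There is a parameterized problem $(X,\kappa)$ that has a psize kernelization, but for which there are no polynomial Turing kernelization $M$ and constant $c$ such that $M$ asks, on every input, at most $c$ (possibly adaptive) queries. -/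

import Mathlib

/-! ### Parameterizations -/

/-- A parameterization: a function `κ : {0,1}* → ℕ` that is computable in polynomial time by a
Turing machine and satisfies the standing assumption `κ x ≤ |x|`.  Values are output in unary;
since `κ x ≤ |x|`, this gives the same notion as binary output. -/
def IsParameterization (κ : List Bool → ℕ) : Prop :=
  (∀ x, κ x ≤ x.length) ∧
    Nonempty (Turing.TM2ComputableInPolyTime (id : List Bool → List Bool)
      Computability.unaryEncodeNat κ)

/-! ### Oracle Turing machines -/

/-- An oracle Turing machine over the alphabet `{0,1}`: a multi-stack machine as in Mathlib, with
input stack `k₀`, together with an oracle.  The stack `k₁` is the query stack and `ask` is the query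
label.  When control is at `ask`, the word on the query stack (top symbol first) is submitted to the
oracle, the answer is recorded in the internal state by `answer`, the query stack is erased,
and then the function labelled `ask` is executed; all this counts as one step.
The machine decides by halting in an internal state that is accepting or not. -/
structure OracleTM extends Turing.TM2ComputableAux Bool Bool where
  /-- all stack alphabets are finite -/
  finiteAlphabets : ∀ k, Finite (tm.Γ k)
  /-- the query label -/
  ask : tm.Λ
  /-- how an answer of the oracle is recorded in the internal state -/
  answer : Bool → tm.σ → tm.σ
  /-- the accepting internal states -/
  accept : tm.σ → Bool

namespace OracleTM

/-- The initial configuration on input `x`. -/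
def init (M : OracleTM) (x : List Bool) : M.tm.Cfg :=
  Turing.initList M.tm (x.map M.inputAlphabet.symm)

/-- The word on the query stack. -/
def queryWord (M : OracleTM) (S : ∀ k, List (M.tm.Γ k)) : List Bool :=
  (S M.tm.k₁).map M.outputAlphabet

open Classical in
/-- One step of the machine with oracle `O`; `none` if the machine has halted. -/
noncomputable def step (M : OracleTM) (O : Language Bool) : M.tm.Cfg → Option M.tm.Cfg
  | ⟨none, _, _⟩ => none
  | ⟨some l, v, S⟩ =>
    if l = M.ask then
      some (Turing.TM2.stepAux (M.tm.m l) (M.answer (decide (M.queryWord S ∈ O)) v)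
        (Function.update S M.tm.k₁ []))
    else some (Turing.TM2.stepAux (M.tm.m l) v S)

open Classical in
/-- The list of queries (of length at most one) asked by the step leaving a configuration. -/
noncomputable def asked (M : OracleTM) : M.tm.Cfg → List (List Bool)
  | ⟨none, _, _⟩ => []
  | ⟨some l, _, S⟩ => if l = M.ask then [M.queryWord S] else []

/-- Run the machine for at most `t` steps: the configuration reached and the queries asked, in
order. -/
noncomputable def run (M : OracleTM) (O : Language Bool) :
    ℕ → M.tm.Cfg → M.tm.Cfg × List (List Bool)
  | 0, c => (c, [])
  | t + 1, c =>
    match M.step O c with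
    | none => (c, [])
    | some c' => ((M.run O t c').1, M.asked c ++ (M.run O t c').2)

/-- With oracle `O` and input `x`, the machine halts within `t` steps with output `b`, having asked
exactly the queries `qs` (in this order, with repetitions) during the computation. -/
def HaltsWith (M : OracleTM) (O : Language Bool) (x : List Bool) (t : ℕ) (b : Bool)
    (qs : List (List Bool)) : Prop :=
  (M.run O t (M.init x)).1.l = none ∧ M.accept (M.run O t (M.init x)).1.var = b ∧
    (M.run O t (M.init x)).2 = qs

/-- With oracle `O` and input `x`, the machine asks at most `c` queries before it halts. -/
def AsksAtMost (M : OracleTM) (O : Language Bool) (x : List Bool) (c : ℕ) : Prop :=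
  ∀ t b qs, M.HaltsWith O x t b qs → qs.length ≤ c

end OracleTM

/-! ### Boolean circuits -/

/-- Gates of a circuit: input bits, constants, and the connectives, which refer to earlier gates by
their position in the circuit. -/
inductive Gate where
  | input (i : ℕ)
  | const (b : Bool)
  | not (i : ℕ)
  | and (i j : ℕ)
  | or (i j : ℕ)

namespace Gate

/-- The gate refers only to the `n` input bits and to the first `m` gates. -/
def WF (n m : ℕ) : Gate → Prop
  | input i => i < n
  | const _ => True
  | not i => i < m
  | and i j => i < m ∧ j < m
  | or i j => i < m ∧ j < m

/-- The value of a gate, given the input bits `a` and the values `w` of the earlier gates. -/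
def eval (a w : List Bool) : Gate → Bool
  | input i => a.getD i false
  | const b => b
  | not i => !(w.getD i false)
  | and i j => w.getD i false && w.getD j false
  | or i j => w.getD i false || w.getD j false

/-- Self-delimiting unary code of a number. -/
def encodeIndex (n : ℕ) : List Bool := List.replicate n true ++ [false]

/-- Binary code of a gate: a tag followed by the indices. -/
def encode : Gate → List Bool
  | input i => [false, false] ++ encodeIndex i
  | const b => [false, true, b]
  | not i => [true, false, false] ++ encodeIndex i
  | and i j => [true, false, true] ++ encodeIndex i ++ encodeIndex j
  | or i j => [true, true] ++ encodeIndex i ++ encodeIndex j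

end Gate

/-- A Boolean circuit, as the list of its gates in topological order; the last gate is the output
gate.  Its size is the number of gates, i.e. the length of the list. -/
abbrev Circuit := List Gate

namespace Circuit

/-- `C` is a circuit with `n` inputs: it has an output gate, and each gate refers only to
existing inputs and to earlier gates. -/
def WF (n : ℕ) (C : Circuit) : Prop :=
  C ≠ [] ∧ ∀ (m : ℕ) (g : Gate), C[m]? = some g → g.WF n m

/-- The values of all gates on the input bits `a`. -/
def values (a : List Bool) (C : Circuit) : List Bool :=
  C.foldl (fun w g => w ++ [g.eval a w]) []

/-- The output of the circuit on the input bits `a`. -/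
def eval (C : Circuit) (a : List Bool) : Bool := (C.values a).getLastD false

/-- Binary code of a circuit. -/
def encode (C : Circuit) : List Bool := C.flatMap Gate.encode

end Circuit

/-! ### Kernelizations -/

/-- `M` is a polynomial Turing kernelization for `(X, κ)`: with oracle `X` it decides `X` in
polynomial time, and on input `x` all its queries have size polynomial in `κ x`. -/
def IsPolyTuringKernelization (X : Language Bool) (κ : List Bool → ℕ) (M : OracleTM) : Prop :=
  ∃ time size : Polynomial ℕ, ∀ x, ∃ b qs,
    M.HaltsWith X x (time.eval x.length) b qs ∧ (b = true ↔ x ∈ X) ∧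
      ∀ q ∈ qs, q.length ≤ size.eval (κ x)

/-- `M` runs in polynomial time for every oracle, and on every input the queries that it asks do
not depend on the oracle. -/
def IsPolyTimeNonadaptive (M : OracleTM) : Prop :=
  ∃ time : Polynomial ℕ, ∀ x, ∃ qs, ∀ O, ∃ b, M.HaltsWith O x (time.eval x.length) b qs

/-- A polynomial truth-table kernelization: a nonadaptive polynomial Turing kernelization. -/
def IsPolyTruthTableKernelization (X : Language Bool) (κ : List Bool → ℕ) (M : OracleTM) : Prop :=
  IsPolyTuringKernelization X κ M ∧ IsPolyTimeNonadaptive M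

open Classical in
/-- A psize kernelization: a polynomial truth-table kernelization that, on inputs with parameter
value `k`, asks at most `poly(k)` queries and whose output is that of a circuit of size `poly(k)`,
computable from the input in polynomial time, that is fed with the answers of the oracle. -/
def IsPsizeKernelization (X : Language Bool) (κ : List Bool → ℕ) (M : OracleTM) : Prop :=
  IsPolyTruthTableKernelization X κ M ∧
  (∃ number : Polynomial ℕ, ∀ x, M.AsksAtMost X x (number.eval (κ x))) ∧
  ∃ (C : List Bool → Circuit) (size : Polynomial ℕ),
    Nonempty (Turing.TM2ComputableInPolyTime (id : List Bool → List Bool) Circuit.encode C) ∧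
    ∀ x, (C x).length ≤ size.eval (κ x) ∧
      ∀ O t b qs, M.HaltsWith O x t b qs →
        (C x).WF qs.length ∧ (C x).eval (qs.map fun q => decide (q ∈ O)) = b

/-! For `A : ℕ → Bool`, attach to a word with `u` ones and `v` zeros the window `[u, u + log₂ (v +
1)]`. Its right end is the parameter `logParam`, and the word lies in `windowLanguage A` iff `A`
holds somewhere in its window.

Upper bound, for every `A`: the window of `1^j` is `{j}`, so the query `1^j` reads off `A j`. The
disjunction of these answers over the window of `x` decides `x`, and both the number and the lengths
of the queries are at most `logParam x + 1` (`isPsizeKernelization_windowMachine`). The work here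
lies in building explicit machines for the parameter, the queries and the circuit.

Lower bound, for a suitable `A`: `longWord k` has parameter `2k` and window `[k, 2k]`, whereas a
query of length at most `p(2k)` has a window of only logarithmic size in `p(2k)`. For large `k`, any
`c` such windows miss some `j` in `[k, 2k]` (`exists_mul_log_le`, `exists_uncovered`). If `A`
vanishes on `[k, 2k]`, setting `A j` to true puts `longWord k` into the language but changes no
answer in the run, hence not the output.

Such a change is possible beyond any finite part of `A`, so the sequences that defeat a given
machine, `c` and `p` contain a dense open set (`dense_interior_not_decides`). There are countably
many behaviours of machines (`OracleTM.countable_range_haltsWith`), so by the Baire category theorem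
one `A` defeats them all. Running time plays no role in this half. -/

open Function

/-! ### Determinism of runs and their dependence on the oracle. -/

namespace OracleTM

theorem run_of_halted (M : OracleTM) (O : Language Bool) (t : ℕ) (c : M.tm.Cfg)
    (h : c.l = none) : M.run O t c = (c, []) := by
  obtain ⟨l, v, S⟩ := c
  change l = none at h
  subst h
  cases t <;> rfl

theorem run_mono (M : OracleTM) (O : Language Bool) {s t : ℕ} (hst : s ≤ t) (c : M.tm.Cfg)
    (h : (M.run O s c).1.l = none) : M.run O t c = M.run O s c := by
  induction s generalizing t c with
  | zero => exact M.run_of_halted O t c h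
  | succ s ih =>
    obtain ⟨t, rfl⟩ : ∃ t', t = t' + 1 := ⟨t - 1, by omega⟩
    rw [run, run] at *
    cases hc : M.step O c with
    | none => rfl
    | some c' =>
      simp only [hc] at h ⊢
      rw [ih (by omega) c' h]

theorem HaltsWith.unique {M : OracleTM} {O : Language Bool} {x : List Bool} {s t : ℕ}
    {b b' : Bool} {qs qs' : List (List Bool)} (h : M.HaltsWith O x s b qs)
    (h' : M.HaltsWith O x t b' qs') : b = b' ∧ qs = qs' := by
  obtain ⟨h1, h2, h3⟩ := h
  obtain ⟨h1', h2', h3'⟩ := h'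
  have key : M.run O t (M.init x) = M.run O s (M.init x) := by
    rcases le_total s t with hst | hst
    · exact M.run_mono O hst _ h1
    · exact (M.run_mono O hst _ h1').symm
  rw [key] at h2' h3'
  exact ⟨h2.symm.trans h2', h3.symm.trans h3'⟩

theorem HaltsWith.mono {M : OracleTM} {O : Language Bool} {x : List Bool} {s t : ℕ}
    {b : Bool} {qs : List (List Bool)} (h : M.HaltsWith O x s b qs) (hst : s ≤ t) :
    M.HaltsWith O x t b qs := by
  rw [HaltsWith, M.run_mono O hst _ h.1]
  exact h

/-- The oracle enters a run only through the answers to the queries actually asked. Agreement on the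
queries of the run with `O` suffices even for adaptive machines: equal answers so far force the same
next configuration. -/
theorem run_congr (M : OracleTM) {O O' : Language Bool} (t : ℕ) (c : M.tm.Cfg)
    (h : ∀ q ∈ (M.run O t c).2, q ∈ O ↔ q ∈ O') : M.run O' t c = M.run O t c := by
  induction t generalizing c with
  | zero => rfl
  | succ t ih =>
    have hs : M.step O' c = M.step O c := by
      obtain ⟨_ | l, v, S⟩ := c
      · rfl
      · by_cases hl : l = M.ask
        · have hq : M.queryWord S ∈ O ↔ M.queryWord S ∈ O' := by
            apply h
            simp [run, step, asked, hl]
          simp only [step, if_pos hl]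
          rw [decide_eq_decide.2 hq]
        · simp [step, hl]
    rw [run, run, hs]
    rw [run] at h
    cases hc : M.step O c with
    | none => rfl
    | some c' =>
      simp only [hc, List.mem_append] at h ⊢
      rw [ih c' fun q hq => h q (Or.inr hq)]

theorem HaltsWith.congr {M : OracleTM} {O O' : Language Bool} {x : List Bool} {t : ℕ}
    {b : Bool} {qs : List (List Bool)} (h : M.HaltsWith O x t b qs)
    (hq : ∀ q ∈ qs, q ∈ O ↔ q ∈ O') : M.HaltsWith O' x t b qs := by
  obtain ⟨h1, h2, rfl⟩ := h
  rw [HaltsWith, M.run_congr t _ hq]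
  exact ⟨h1, h2, rfl⟩

end OracleTM

/-! ### There are only countably many behaviours of oracle machines -/

namespace MachineCode

/-- Programs over alphabets, states and labels that are initial segments of `ℕ`; functions are
given by their tables. -/
inductive StmtCode where
  | push (k : ℕ) (f : List ℕ) (q : StmtCode)
  | peek (k : ℕ) (f : List (List ℕ)) (q : StmtCode)
  | pop (k : ℕ) (f : List (List ℕ)) (q : StmtCode)
  | load (f : List ℕ) (q : StmtCode)
  | branch (f : List Bool) (q₁ q₂ : StmtCode)
  | goto (f : List ℕ)
  | halt
  deriving Encodable

/-- Configurations of coded machines. -/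
abbrev CfgCode := Option ℕ × ℕ × (ℕ → List ℕ)

/-- The position of an optional symbol in a table. -/
def optIndex : Option ℕ → ℕ
  | none => 0
  | some n => n + 1

/-- Execution of a coded statement. -/
def stepAux : StmtCode → ℕ → (ℕ → List ℕ) → CfgCode
  | .push k f q, v, S => stepAux q v (update S k (f.getD v 0 :: S k))
  | .peek k f q, v, S => stepAux q ((f.getD v []).getD (optIndex (S k).head?) 0) S
  | .pop k f q, v, S =>
    stepAux q ((f.getD v []).getD (optIndex (S k).head?) 0) (update S k (S k).tail)
  | .load f q, v, S => stepAux q (f.getD v 0) S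
  | .branch f q₁ q₂, v, S => cond (f.getD v false) (stepAux q₁ v S) (stepAux q₂ v S)
  | .goto f, v, S => (some (f.getD v 0), v, S)
  | .halt, v, S => (none, v, S)

/-- The table of a function. -/
def table {α β : Type} {n : ℕ} (e : α ≃ Fin n) (f : α → β) : List β :=
  List.ofFn fun i => f (e.symm i)

theorem table_getD {α β : Type} {n : ℕ} (e : α ≃ Fin n) (f : α → β) (a : α) (d : β) :
    (table e f).getD (e a) d = f a := by
  simp [table, List.getD]

/-- The table of a function of an optional argument. -/
def optTable {α β : Type} {n : ℕ} (e : α ≃ Fin n) (f : Option α → β) : List β :=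
  f none :: table e fun a => f (some a)

theorem optTable_getD {α β : Type} {n : ℕ} (e : α ≃ Fin n) (f : Option α → β) (a : Option α)
    (d : β) : (optTable e f).getD (optIndex (a.map fun a => (e a : ℕ))) d = f a := by
  cases a with
  | none => rfl
  | some a =>
    simp only [optTable, optIndex, Option.map_some, List.getD_cons_succ]
    exact table_getD e _ a d

/-! ### Simulation of statements by their codes. -/

section Encode

variable {K Λ σ : Type} {Γ : K → Type} {s l : ℕ} {g : K → ℕ}
  (eK : K → ℕ) (eσ : σ ≃ Fin s) (eΛ : Λ ≃ Fin l) (eΓ : ∀ k, Γ k ≃ Fin (g k))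

/-- The code of a statement. -/
def encodeStmt : Turing.TM2.Stmt Γ Λ σ → StmtCode
  | .push k f q => .push (eK k) (table eσ fun v => (eΓ k (f v) : ℕ)) (encodeStmt q)
  | .peek k f q =>
    .peek (eK k) (table eσ fun v => optTable (eΓ k) fun o => (eσ (f v o) : ℕ)) (encodeStmt q)
  | .pop k f q =>
    .pop (eK k) (table eσ fun v => optTable (eΓ k) fun o => (eσ (f v o) : ℕ)) (encodeStmt q)
  | .load f q => .load (table eσ fun v => (eσ (f v) : ℕ)) (encodeStmt q)
  | .branch f q₁ q₂ => .branch (table eσ f) (encodeStmt q₁) (encodeStmt q₂)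
  | .goto f => .goto (table eσ fun v => (eΛ (f v) : ℕ))
  | .halt => .halt

/-- The code of the contents of the stacks. -/
noncomputable def encodeStk (S : ∀ k, List (Γ k)) : ℕ → List ℕ :=
  extend eK (fun k => (S k).map fun a => (eΓ k a : ℕ)) fun _ => []

/-- The code of a configuration. -/
noncomputable def encodeCfg (c : Turing.TM2.Cfg Γ Λ σ) : CfgCode :=
  (c.l.map fun a => (eΛ a : ℕ), (eσ c.var : ℕ), encodeStk eK eΓ c.stk)

variable {eK}

theorem encodeStk_apply (hK : Injective eK) (S : ∀ k, List (Γ k)) (k : K) :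
    encodeStk eK eΓ S (eK k) = (S k).map fun a => (eΓ k a : ℕ) :=
  hK.extend_apply _ _ _

theorem encodeStk_update (hK : Injective eK) [DecidableEq K] (S : ∀ k, List (Γ k)) (k : K)
    (w : List (Γ k)) :
    encodeStk eK eΓ (update S k w) =
      update (encodeStk eK eΓ S) (eK k) (w.map fun a => (eΓ k a : ℕ)) := by
  funext n
  by_cases hn : ∃ k', eK k' = n
  · obtain ⟨k', rfl⟩ := hn
    rw [encodeStk_apply eΓ hK]
    by_cases hk : k' = k
    · subst hk
      simp
    · rw [update_of_ne hk, update_of_ne (hK.ne hk), encodeStk_apply eΓ hK]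
  · rw [update_of_ne (fun h => hn ⟨k, h.symm⟩), encodeStk, encodeStk,
      extend_apply' _ _ _ hn, extend_apply' _ _ _ hn]

/-- Encoding commutes with execution. Table lookups hit valid positions, so the default values in
`stepAux` are never used; injectivity of `eK` keeps distinct stacks apart. -/
theorem stepAux_encode (hK : Injective eK) [DecidableEq K] (q : Turing.TM2.Stmt Γ Λ σ)
    (v : σ) (S : ∀ k, List (Γ k)) :
    stepAux (encodeStmt eK eσ eΛ eΓ q) (eσ v) (encodeStk eK eΓ S) =
      encodeCfg eK eσ eΛ eΓ (Turing.TM2.stepAux q v S) := by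
  induction q generalizing v S with
  | push k f q ih =>
    simp only [encodeStmt, stepAux, Turing.TM2.stepAux, table_getD, ← ih,
      encodeStk_update eΓ hK, encodeStk_apply eΓ hK, List.map_cons]
  | peek k f q ih =>
    simp only [encodeStmt, stepAux, Turing.TM2.stepAux, table_getD, ← ih,
      encodeStk_apply eΓ hK, List.head?_map, optTable_getD]
  | pop k f q ih =>
    simp only [encodeStmt, stepAux, Turing.TM2.stepAux, table_getD, ← ih,
      encodeStk_update eΓ hK, encodeStk_apply eΓ hK, List.head?_map, optTable_getD,
      List.map_tail]
  | load f q ih => simp only [encodeStmt, stepAux, Turing.TM2.stepAux, table_getD, ← ih]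
  | branch f q₁ q₂ ih₁ ih₂ =>
    simp only [encodeStmt, stepAux, Turing.TM2.stepAux, table_getD]
    cases f v
    · exact ih₂ v S
    · exact ih₁ v S
  | goto f => simp only [encodeStmt, stepAux, Turing.TM2.stepAux, table_getD]; rfl
  | halt => rfl

end Encode

/-- The finite data of an oracle machine. -/
structure _root_.MachineCode where
  prog : List StmtCode
  inStack : ℕ
  queryStack : ℕ
  main : ℕ
  initial : ℕ
  ask : ℕ
  answer : Bool → List ℕ
  accept : List Bool
  inAlphabet : Bool → ℕ
  outAlphabet : List Bool

instance : Countable MachineCode := by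
  let f : MachineCode → List StmtCode × ℕ × ℕ × ℕ × ℕ × ℕ × (Bool → List ℕ) × List Bool ×
      (Bool → ℕ) × List Bool := fun c =>
    (c.prog, c.inStack, c.queryStack, c.main, c.initial, c.ask, c.answer, c.accept,
      c.inAlphabet, c.outAlphabet)
  have hf : Injective f := by
    rintro ⟨⟩ ⟨⟩ h
    simpa [f] using h
  exact hf.countable

/-! ### Runs of coded machines. -/

variable (D : MachineCode) (O : Language Bool)

/-- The word on the query stack of a coded machine. -/
def queryWord (S : ℕ → List ℕ) : List Bool :=
  (S D.queryStack).map fun n => D.outAlphabet.getD n false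

open Classical in
/-- One step of a coded machine. -/
noncomputable def step : CfgCode → Option CfgCode
  | (none, _, _) => none
  | (some l, v, S) =>
    if l = D.ask then
      some (stepAux (D.prog.getD l .halt) ((D.answer (decide (D.queryWord S ∈ O))).getD v 0)
        (update S D.queryStack []))
    else some (stepAux (D.prog.getD l .halt) v S)

/-- The queries asked by a coded machine in one step. -/
def asked : CfgCode → List (List Bool)
  | (none, _, _) => []
  | (some l, _, S) => if l = D.ask then [D.queryWord S] else []

/-- The run of a coded machine. -/
noncomputable def run : ℕ → CfgCode → CfgCode × List (List Bool)
  | 0, c => (c, [])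
  | t + 1, c =>
    match D.step O c with
    | none => (c, [])
    | some d => ((run t d).1, D.asked c ++ (run t d).2)

/-- The initial configuration of a coded machine. -/
def init (x : List Bool) : CfgCode :=
  (some D.main, D.initial, update (fun _ => []) D.inStack (x.map D.inAlphabet))

/-- The behaviour of a coded machine. -/
def HaltsWith (x : List Bool) (t : ℕ) (b : Bool) (qs : List (List Bool)) : Prop :=
  (D.run O t (D.init x)).1.1 = none ∧
    D.accept.getD (D.run O t (D.init x)).1.2.1 false = b ∧ (D.run O t (D.init x)).2 = qs

end MachineCode

theorem Turing.initList_stk (tm : Turing.FinTM2) (s : List (tm.Γ tm.k₀)) :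
    (Turing.initList tm s).stk = update (fun _ => []) tm.k₀ s := by
  funext k
  by_cases h : k = tm.k₀
  · subst h
    simp [Turing.initList]
  · simp [Turing.initList, h]

-- All components of a machine are finite, so numbering them turns the machine into tables. Step,
-- queries and run then correspond under `encodeCfg`, and the two halting relations coincide.
open MachineCode in
theorem OracleTM.exists_code (M : OracleTM) : ∃ D : MachineCode, D.HaltsWith = M.HaltsWith := by
  have hfin := M.finiteAlphabets
  let _ := M.tm.kFin
  let _ := M.tm.ΛFin
  let _ := M.tm.σFin
  let eK : M.tm.K → ℕ := fun k => Finite.equivFin M.tm.K k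
  have hK : Injective eK := fun a b h => (Finite.equivFin M.tm.K).injective (Fin.ext h)
  let eσ := Finite.equivFin M.tm.σ
  let eΛ := Finite.equivFin M.tm.Λ
  let eΓ := fun k => Finite.equivFin (M.tm.Γ k)
  let D : MachineCode :=
    { prog := table eΛ fun l => encodeStmt eK eσ eΛ eΓ (M.tm.m l)
      inStack := eK M.tm.k₀
      queryStack := eK M.tm.k₁
      main := eΛ M.tm.main
      initial := eσ M.tm.initialState
      ask := eΛ M.ask
      answer := fun b => table eσ fun v => (eσ (M.answer b v) : ℕ)
      accept := table eσ M.accept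
      inAlphabet := fun b => eΓ _ (M.inputAlphabet.symm b)
      outAlphabet := table (eΓ _) M.outputAlphabet }
  refine ⟨D, ?_⟩
  let enc : M.tm.Cfg → CfgCode := encodeCfg eK eσ eΛ eΓ
  have hquery : ∀ S, D.queryWord (encodeStk eK eΓ S) = M.queryWord S := by
    intro S
    simp only [MachineCode.queryWord, D, encodeStk_apply eΓ hK, List.map_map, queryWord]
    exact List.map_congr_left fun a _ => table_getD _ _ _ _
  have hask : ∀ l, ((eΛ l : ℕ) = D.ask) ↔ l = M.ask := by
    intro l
    simp [D, ← Fin.ext_iff]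
  have hprog : ∀ l, D.prog.getD (eΛ l) .halt = encodeStmt eK eσ eΛ eΓ (M.tm.m l) :=
    fun l => table_getD eΛ (fun l => encodeStmt eK eσ eΛ eΓ (M.tm.m l)) l .halt
  have hanswer : ∀ b v, (D.answer b).getD (eσ v) 0 = eσ (M.answer b v) :=
    fun b v => table_getD eσ (fun v => (eσ (M.answer b v) : ℕ)) v 0
  have haccept : ∀ v, D.accept.getD (eσ v) false = M.accept v :=
    fun v => table_getD eσ M.accept v false
  have hupd : ∀ S, update (encodeStk eK eΓ S) D.queryStack [] =
      encodeStk eK eΓ (update S M.tm.k₁ []) := by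
    intro S
    rw [encodeStk_update eΓ hK]
    rfl
  have hinit : ∀ x, D.init x = enc (M.init x) := by
    intro x
    have hs := encodeStk_update eΓ hK (fun _ => []) M.tm.k₀ (x.map M.inputAlphabet.symm)
    have hnil : encodeStk eK eΓ (fun _ => []) = fun _ => [] := by
      funext n
      by_cases hn : ∃ k', eK k' = n
      · obtain ⟨k', rfl⟩ := hn
        rw [encodeStk_apply eΓ hK]
        rfl
      · exact extend_apply' _ _ _ hn
    have he : enc (M.init x) =
        (some (eΛ M.tm.main : ℕ), (eσ M.tm.initialState : ℕ), encodeStk eK eΓ (M.init x).stk) := rfl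
    rw [he, OracleTM.init, Turing.initList_stk, hs, hnil, List.map_map]
    rfl
  -- From here on only the equations just proved about the code are needed.
  clear_value D
  have hstep : ∀ O c, D.step O (enc c) = (M.step O c).map enc := by
    rintro O ⟨_ | l, v, S⟩
    · rfl
    · have he : enc ⟨some l, v, S⟩ = (some (eΛ l : ℕ), (eσ v : ℕ), encodeStk eK eΓ S) := rfl
      rw [he]
      by_cases hl : l = M.ask
      · have hl' := (hask l).2 hl
        rw [MachineCode.step, if_pos hl', hprog, hquery, hanswer, hupd,
          stepAux_encode eσ eΛ eΓ hK, step, if_pos hl]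
        rfl
      · have hl' := (hask l).not.2 hl
        rw [MachineCode.step, if_neg hl', hprog, stepAux_encode eσ eΛ eΓ hK, step, if_neg hl]
        rfl
  have hasked : ∀ c, D.asked (enc c) = M.asked c := by
    rintro ⟨_ | l, v, S⟩
    · rfl
    · have he : enc ⟨some l, v, S⟩ = (some (eΛ l : ℕ), (eσ v : ℕ), encodeStk eK eΓ S) := rfl
      rw [he, MachineCode.asked, asked, hquery]
      by_cases hl : l = M.ask
      · rw [if_pos ((hask l).2 hl), if_pos hl]
      · rw [if_neg ((hask l).not.2 hl), if_neg hl]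
  have hrun : ∀ O t c, D.run O t (enc c) = (enc (M.run O t c).1, (M.run O t c).2) := by
    intro O t
    induction t with
    | zero => intro c; rfl
    | succ t ih =>
      intro c
      rw [MachineCode.run, OracleTM.run, hstep]
      cases M.step O c with
      | none => rfl
      | some c' => simp only [Option.map_some, ih, hasked]
  funext O x t b qs
  have h1 : ∀ c, (enc c).1 = none ↔ c.l = none := fun c => Option.map_eq_none_iff
  have h2 : ∀ c, D.accept.getD (enc c).2.1 false = M.accept c.var := fun c => haccept c.var
  simp only [MachineCode.HaltsWith, HaltsWith, hinit, hrun, h1, h2]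

/-- Machines carry arbitrary types for stacks, labels and states, so it is their behaviours that are
counted, through the countable type of codes. -/
theorem OracleTM.countable_range_haltsWith :
    (Set.range fun M : OracleTM => M.HaltsWith).Countable := by
  refine (Set.countable_range MachineCode.HaltsWith).mono ?_
  rintro _ ⟨M, rfl⟩
  exact M.exists_code

open Filter Topology

/-! ### The languages and the parameterization -/

/-- The number of ones plus the logarithm of the number of zeros. -/
def logParam (x : List Bool) : ℕ := x.count true + Nat.log 2 (x.count false + 1)

/-- The words `x` for which `A` holds somewhere between the number of ones in `x` and
`logParam x`. -/
def windowLanguage (A : ℕ → Bool) : Language Bool :=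
  {x | ∃ j, x.count true ≤ j ∧ j ≤ logParam x ∧ A j = true}

theorem mem_windowLanguage {A : ℕ → Bool} {x : List Bool} :
    x ∈ windowLanguage A ↔ ∃ j, x.count true ≤ j ∧ j ≤ logParam x ∧ A j = true :=
  Iff.rfl

theorem log_two_succ_le (m : ℕ) : Nat.log 2 (m + 1) ≤ m :=
  Nat.lt_succ_iff.1 (Nat.log_lt_of_lt_pow (Nat.succ_ne_zero m) Nat.lt_two_pow_self)

theorem logParam_le_length (x : List Bool) : logParam x ≤ x.length := by
  rw [logParam, ← List.count_true_add_count_false x]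
  exact Nat.add_le_add_left (log_two_succ_le _) _

theorem mem_windowLanguage_congr {A A' : ℕ → Bool} {x : List Bool}
    (h : ∀ j, x.count true ≤ j → j ≤ logParam x → A j = A' j) :
    x ∈ windowLanguage A ↔ x ∈ windowLanguage A' := by
  rw [mem_windowLanguage, mem_windowLanguage]
  refine exists_congr fun j => ⟨fun ⟨h1, h2, h3⟩ => ⟨h1, h2, ?_⟩, fun ⟨h1, h2, h3⟩ => ⟨h1, h2, ?_⟩⟩
  · rw [← h j h1 h2, h3]
  · rw [h j h1 h2, h3]

/-! ### Exponential growth -/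

theorem Polynomial.eventually_eval_lt_two_pow (P : Polynomial ℕ) :
    ∀ᶠ n in atTop, P.eval n < 2 ^ n := by
  have key : Tendsto (fun n : ℕ => ((P.eval n : ℕ) : ℝ) / 2 ^ n) atTop (𝓝 0) := by
    induction P using Polynomial.induction_on' with
    | add p q hp hq =>
      simp only [Polynomial.eval_add, Nat.cast_add, add_div]
      simpa using hp.add hq
    | monomial d a =>
      have h := (tendsto_pow_const_div_const_pow_of_one_lt d (one_lt_two (α := ℝ))).const_mul
        (a : ℝ)
      simpa [Polynomial.eval_monomial, mul_div_assoc] using h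
  filter_upwards [key.eventually (gt_mem_nhds one_pos)] with n hn
  rw [div_lt_one (by positivity)] at hn
  exact_mod_cast hn

/-- This provides the `k` for the diagonalization: `c` windows of words of length at most `p(2k)`
contain at most `k` numbers in total, one fewer than `[k, 2k]`. -/
theorem exists_mul_log_le (p : Polynomial ℕ) (c N : ℕ) :
    ∃ k, N ≤ k ∧ c * (Nat.log 2 (p.eval (2 * k) + 1) + 1) ≤ k := by
  obtain ⟨s, hN, hs⟩ := ((eventually_ge_atTop N).and
    (Polynomial.eventually_eval_lt_two_pow
      (p.comp (Polynomial.C (2 * (c + 1)) * Polynomial.X) + 1))).exists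
  -- With `k = (c + 1) * s`, the choice of `s` says `p(2k) + 1 < 2 ^ s`, so the logarithm is below
  -- `s`. The factor `c + 1` instead of `c` keeps `k ≥ N` when `c = 0`.
  refine ⟨(c + 1) * s, by nlinarith, ?_⟩
  simp only [Polynomial.eval_add, Polynomial.eval_comp, Polynomial.eval_mul, Polynomial.eval_C,
    Polynomial.eval_X, Polynomial.eval_one, mul_assoc] at hs
  exact Nat.mul_le_mul (Nat.le_succ c) (Nat.log_lt_of_lt_pow (Nat.succ_ne_zero _) hs)

theorem Polynomial.countable_nat : Countable (Polynomial ℕ) :=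
  Cardinal.mk_le_aleph0_iff.1 (Polynomial.cardinalMk_le_max.trans (by simp))

/-! ### Diagonalization -/

/-- The word with `k` ones and `2 ^ k - 1` zeros. -/
def longWord (k : ℕ) : List Bool := List.replicate k true ++ List.replicate (2 ^ k - 1) false

theorem count_true_longWord (k : ℕ) : (longWord k).count true = k := by
  simp [longWord, List.count_replicate]

theorem logParam_longWord (k : ℕ) : logParam (longWord k) = 2 * k := by
  have h : (longWord k).count false + 1 = 2 ^ k := by
    simp [longWord, List.count_replicate, Nat.sub_add_cancel Nat.one_le_two_pow]
  rw [logParam, h, count_true_longWord, Nat.log_pow one_lt_two, two_mul]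

/-- The behaviour `h` with oracle `windowLanguage A` decides this language with at most `c`
queries, each of length bounded by `p` in the parameter. -/
def DecidesWithFewQueries
    (h : Language Bool → List Bool → ℕ → Bool → List (List Bool) → Prop) (c : ℕ)
    (p : Polynomial ℕ) (A : ℕ → Bool) : Prop :=
  ∀ x, ∃ t b qs, h (windowLanguage A) x t b qs ∧ (b = true ↔ x ∈ windowLanguage A) ∧
    (∀ q ∈ qs, q.length ≤ p.eval (logParam x)) ∧ qs.length ≤ c

theorem exists_uncovered (qs : List (List Bool)) {c k n : ℕ} (hc : qs.length ≤ c)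
    (hn : ∀ q ∈ qs, q.length ≤ n) (hk : c * (Nat.log 2 (n + 1) + 1) ≤ k) :
    ∃ j, k ≤ j ∧ j ≤ 2 * k ∧ ∀ q ∈ qs, ¬ (q.count true ≤ j ∧ j ≤ logParam q) := by
  classical
  have hcard : (qs.toFinset.biUnion fun q => Finset.Icc (q.count true) (logParam q)).card <
      (Finset.Icc k (2 * k)).card := by
    calc _ ≤ qs.toFinset.card * (Nat.log 2 (n + 1) + 1) := by
          refine Finset.card_biUnion_le_card_mul _ _ _ fun q hq => ?_
          have h1 : q.count false ≤ n := List.count_le_length.trans (hn q (List.mem_toFinset.1 hq))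
          have h2 : Nat.log 2 (q.count false + 1) ≤ Nat.log 2 (n + 1) :=
            Nat.log_mono_right (by omega)
          rw [Nat.card_Icc, logParam]
          omega
      _ ≤ c * (Nat.log 2 (n + 1) + 1) :=
          Nat.mul_le_mul_right _ ((List.toFinset_card_le qs).trans hc)
      _ < _ := by
          rw [Nat.card_Icc]
          omega
  obtain ⟨j, hj, hj'⟩ := Finset.exists_mem_notMem_of_card_lt_card hcard
  rw [Finset.mem_Icc] at hj
  refine ⟨j, hj.1, hj.2, fun q hq hjq => hj' ?_⟩
  exact Finset.mem_biUnion.2 ⟨q, List.mem_toFinset.2 hq, Finset.mem_Icc.2 hjq⟩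

/-- Extend the prefix of `A` by false. Either no sequence close to this extension is decided, or
some `B` is, and its run on `longWord k` shows where to flip one bit so that every nearby sequence
is answered wrongly. -/
theorem exists_cylinder_not_decides (M : OracleTM) (c : ℕ) (p : Polynomial ℕ) (A : ℕ → Bool)
    (N : ℕ) : ∃ A' ∈ PiNat.cylinder A N, ∃ N', ∀ B ∈ PiNat.cylinder A' N',
      ¬ DecidesWithFewQueries M.HaltsWith c p B := by
  obtain ⟨k, hNk, hk⟩ := exists_mul_log_le p c N
  set P := p.eval (2 * k) with hP
  let A₀ : ℕ → Bool := fun j => decide (j < N) && A j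
  have hA₀ : A₀ ∈ PiNat.cylinder A N := fun j hj => by simp [A₀, hj]
  -- The prefix of length `P + 2 * k + 1` contains the window `[k, 2k]` and the windows of all words
  -- of length at most `P`.
  by_cases hB : ∃ B ∈ PiNat.cylinder A₀ (P + 2 * k + 1), DecidesWithFewQueries M.HaltsWith c p B
  swap
  · push Not at hB
    exact ⟨A₀, hA₀, _, hB⟩
  obtain ⟨B, hBA, hB⟩ := hB
  obtain ⟨t, b, qs, hrun, hb, hlen, hcard⟩ := hB (longWord k)
  rw [logParam_longWord, ← hP] at hlen
  have hfalse : longWord k ∉ windowLanguage B := by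
    rintro ⟨j, h1, h2, h3⟩
    rw [count_true_longWord] at h1
    rw [logParam_longWord] at h2
    have hj : B j = A₀ j := hBA j (by omega)
    have : ¬ j < N := by omega
    simp [hj, A₀, this] at h3
  obtain ⟨j, hkj, hjk, hj⟩ := exists_uncovered qs hcard hlen hk
  refine ⟨Function.update A₀ j true, fun i hi => ?_, P + 2 * k + 1, fun B' hB' hdec => ?_⟩
  · rw [Function.update_of_ne (by omega)]
    exact hA₀ i hi
  -- On the relevant prefix `B` and `B'` differ only at `j`, which lies in no window of a query.
  · have hagree : ∀ q ∈ qs, q ∈ windowLanguage B ↔ q ∈ windowLanguage B' := by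
      intro q hq
      refine mem_windowLanguage_congr fun i h1 h2 => ?_
      have hi : i < P + 2 * k + 1 := by
        have := logParam_le_length q
        have := hlen q hq
        omega
      have hij : i ≠ j := by
        rintro rfl
        exact hj q hq ⟨h1, h2⟩
      rw [hBA i hi, hB' i hi, Function.update_of_ne hij]
    have htrue : longWord k ∈ windowLanguage B' := by
      refine ⟨j, ?_, ?_, ?_⟩
      · rwa [count_true_longWord]
      · rwa [logParam_longWord]
      · rw [hB' j (by omega), Function.update_self]
    obtain ⟨t', b', qs', hrun', hb', -⟩ := hdec (longWord k)
    have hbb := ((hrun.congr hagree).unique hrun').1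
    exact hfalse (hb.1 (hbb.trans (hb'.2 htrue)))

theorem dense_interior_not_decides (M : OracleTM) (c : ℕ) (p : Polynomial ℕ) :
    Dense (interior {A | ¬ DecidesWithFewQueries M.HaltsWith c p A}) := by
  rw [dense_iff_inter_open]
  rintro U hU ⟨A, hA⟩
  obtain ⟨_, ⟨A₁, N, rfl⟩, hA₁, hsub⟩ :=
    (PiNat.isTopologicalBasis_cylinders fun _ : ℕ => Bool).exists_subset_of_mem_open hA hU
  obtain ⟨A', hA', N', hN'⟩ := exists_cylinder_not_decides M c p A₁ N
  exact ⟨A', hsub hA', mem_interior.2 ⟨_, hN', PiNat.isOpen_cylinder _ A' N',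
    PiNat.self_mem_cylinder A' N'⟩⟩

theorem exists_not_constant_query_kernelization :
    ∃ A : ℕ → Bool, ¬ ∃ (M : OracleTM) (c : ℕ),
      IsPolyTuringKernelization (windowLanguage A) logParam M ∧
        ∀ x, M.AsksAtMost (windowLanguage A) x c := by
  have := Polynomial.countable_nat
  have := OracleTM.countable_range_haltsWith.to_subtype
  -- Indexing by behaviours instead of machines makes the family countable, as the Baire category
  -- theorem requires.
  let U : (Set.range fun M : OracleTM => M.HaltsWith) × ℕ × Polynomial ℕ → Set (ℕ → Bool) :=
    fun i => interior {A | ¬ DecidesWithFewQueries i.1 i.2.1 i.2.2 A}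
  have hdense : Dense (⋂ i, U i) := by
    refine dense_iInter_of_isOpen (fun i => isOpen_interior) ?_
    rintro ⟨⟨_, M, rfl⟩, c, p⟩
    exact dense_interior_not_decides M c p
  obtain ⟨A, hA⟩ := hdense.nonempty
  refine ⟨A, ?_⟩
  rintro ⟨M, c, ⟨time, size, hM⟩, hc⟩
  have hA' := interior_subset (Set.mem_iInter.1 hA (⟨_, M, rfl⟩, c, size))
  refine hA' fun x => ?_
  obtain ⟨b, qs, h1, h2, h3⟩ := hM x
  exact ⟨_, b, qs, h1, h2, h3, hc x _ _ _ h1⟩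

/-! ### Timed reachability -/

/-- In at most `n` steps of `f` one gets from `c` to `c'`, asking the queries `qs`. -/
inductive ReachesIn {α β : Type} (f : α → Option α) (asked : α → List β) :
    ℕ → α → α → List β → Prop
  | refl (n : ℕ) (c : α) : ReachesIn f asked n c c []
  | head {n : ℕ} {c c' c'' : α} {as qs : List β} (h : f c = some c') (ha : asked c = as)
      (h' : ReachesIn f asked n c' c'' qs) : ReachesIn f asked (n + 1) c c'' (as ++ qs)

namespace ReachesIn

variable {α β : Type} {f : α → Option α} {asked : α → List β} {m n : ℕ} {c c' c'' : α}
  {qs qs' : List β}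

theorem mono (h : ReachesIn f asked m c c' qs) (hmn : m ≤ n) : ReachesIn f asked n c c' qs := by
  induction h generalizing n with
  | refl => exact .refl _ _
  | head h ha _ ih =>
    obtain ⟨n, rfl⟩ : ∃ n', n = n' + 1 := ⟨n - 1, by omega⟩
    exact .head h ha (ih (by omega))

theorem trans (h : ReachesIn f asked m c c' qs) (h' : ReachesIn f asked n c' c'' qs') :
    ReachesIn f asked (m + n) c c'' (qs ++ qs') := by
  induction h with
  | refl => exact h'.mono (by omega)
  | head h ha _ ih =>
    rw [List.append_assoc]
    exact (ReachesIn.head h ha (ih h')).mono (by omega)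

theorem evalsToInTime (h : ReachesIn f asked n c c' qs) :
    Nonempty (StateTransition.EvalsToInTime f c (some c') n) := by
  induction h with
  | refl => exact ⟨⟨⟨0, rfl⟩, Nat.zero_le _⟩⟩
  | head h ha _ ih =>
    obtain ⟨⟨⟨s, hs⟩, hle⟩⟩ := ih
    refine ⟨⟨⟨s + 1, ?_⟩, Nat.succ_le_succ hle⟩⟩
    rw [iterate_succ_apply]
    simpa [flip, h] using hs

end ReachesIn

theorem OracleTM.run_of_reachesIn {M : OracleTM} {O : Language Bool} {n : ℕ} {c c' : M.tm.Cfg}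
    {qs : List (List Bool)} (h : ReachesIn (M.step O) M.asked n c c' qs) (hc : c'.l = none) :
    M.run O n c = (c', qs) := by
  induction h with
  | refl => exact M.run_of_halted O _ _ hc
  | head h ha _ ih => simp only [run, h, ih hc, ha]

/-! ### Machines that pop one symbol per step -/

/-- The stacks of our machines. -/
inductive Stack where
  | input | output | zeros | half | counter | spare
  deriving DecidableEq

instance : Fintype Stack where
  elems := {.input, .output, .zeros, .half, .counter, .spare}
  complete := by rintro ⟨⟩ <;> decide

/-- The labels of our machines. -/
inductive Label where
  | scan | test | halve₁ | halve₂ | restore | copy₁ | copy₂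
  | emit₀ | emit₁ | emit₂ | emit₃ | emit₄
  deriving DecidableEq

instance : Fintype Label where
  elems := {.scan, .test, .halve₁, .halve₂, .restore, .copy₁, .copy₂,
    .emit₀, .emit₁, .emit₂, .emit₃, .emit₄}
  complete := by rintro ⟨⟩ <;> decide

/-- The contents of all stacks. -/
def contents (input output zeros half counter spare : List Bool) : Stack → List Bool
  | .input => input
  | .output => output
  | .zeros => zeros
  | .half => half
  | .counter => counter
  | .spare => spare

section contents

variable (i o z h c s w : List Bool)

@[simp] theorem update_contents_input :
    update (contents i o z h c s) .input w = contents w o z h c s := by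
  funext k; cases k <;> rfl

@[simp] theorem update_contents_output :
    update (contents i o z h c s) .output w = contents i w z h c s := by
  funext k; cases k <;> rfl

@[simp] theorem update_contents_zeros :
    update (contents i o z h c s) .zeros w = contents i o w h c s := by
  funext k; cases k <;> rfl

@[simp] theorem update_contents_half :
    update (contents i o z h c s) .half w = contents i o z w c s := by
  funext k; cases k <;> rfl

@[simp] theorem update_contents_counter :
    update (contents i o z h c s) .counter w = contents i o z h w s := by
  funext k; cases k <;> rfl

@[simp] theorem update_contents_spare :
    update (contents i o z h c s) .spare w = contents i o z h c w := by
  funext k; cases k <;> rfl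

theorem contents_nil : contents [] [] [] [] [] [] = fun _ => [] := by
  funext k; cases k <;> rfl

end contents

/-- The internal states: the symbol just popped and the disjunction of the answers. -/
abbrev PopState := Option Bool × Bool

/-- A program that, at each label, pops a symbol from some stack and then, depending on this
symbol, pushes a list of symbols and jumps. -/
abbrev PopProgram := Label → Stack × (Option Bool → List (Stack × Bool) × Option Label)

namespace PopProgram

/-- The statements of our machines. -/
abbrev PopStmt := Turing.TM2.Stmt (fun _ : Stack => Bool) Label PopState

/-- The configurations of our machines. -/
abbrev PopCfg := Turing.TM2.Cfg (fun _ : Stack => Bool) Label PopState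

/-- Push a list of symbols, forget the symbol just popped and jump. -/
def actStmt : List (Stack × Bool) → Option Label → PopStmt
  | [], none => .load (fun v => (none, v.2)) .halt
  | [], some l => .load (fun v => (none, v.2)) (.goto fun _ => l)
  | a :: as, l => .push a.1 (fun _ => a.2) (actStmt as l)

/-- Push a list of symbols. -/
def pushAll (S : Stack → List Bool) (as : List (Stack × Bool)) : Stack → List Bool :=
  as.foldl (fun S a => update S a.1 (a.2 :: S a.1)) S

theorem stepAux_actStmt (as : List (Stack × Bool)) (l : Option Label) (v : PopState)
    (S : Stack → List Bool) :
    Turing.TM2.stepAux (actStmt as l) v S = ⟨l, (none, v.2), pushAll S as⟩ := by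
  induction as generalizing S with
  | nil => cases l <;> rfl
  | cons a as ih => exact ih _

variable (P : PopProgram)

/-- The statement of a label. -/
def stmt (l : Label) : PopStmt :=
  .pop (P l).1 (fun v o => (o, v.2))
    (.branch (fun v => v.1.isNone) (actStmt ((P l).2 none).1 ((P l).2 none).2)
      (.branch (fun v => v.1 == some true)
        (actStmt ((P l).2 (some true)).1 ((P l).2 (some true)).2)
        (actStmt ((P l).2 (some false)).1 ((P l).2 (some false)).2)))

/-- The configuration after the execution of a label. -/
def next (l : Label) (acc : Bool) (S : Stack → List Bool) : PopCfg :=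
  let a := (P l).2 (S (P l).1).head?
  ⟨a.2, (none, acc), pushAll (update S (P l).1 (S (P l).1).tail) a.1⟩

/-- Each label starts and ends with no remembered symbol, so the state between steps is just the
accumulated disjunction `acc`. -/
theorem stepAux_stmt (l : Label) (acc : Bool) (S : Stack → List Bool) :
    Turing.TM2.stepAux (P.stmt l) (none, acc) S = P.next l acc S := by
  simp only [stmt, Turing.TM2.stepAux, next, stepAux_actStmt]
  rcases (S (P l).1).head? with _ | _ | _ <;> rfl

/-- The machine that executes a program, starting at the label `scan`. -/
def toFinTM2 (k₁ : Stack) : Turing.FinTM2 where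
  K := Stack
  k₀ := .input
  k₁ := k₁
  Γ _ := Bool
  Λ := Label
  main := .scan
  σ := PopState
  initialState := (none, false)
  Γk₀Fin := inferInstanceAs (Fintype Bool)
  m := P.stmt

/-- The oracle machine that executes a program, asking at the label `test`, and accepts if one of
the answers was positive. -/
def toOracleTM : OracleTM where
  tm := P.toFinTM2 .output
  inputAlphabet := Equiv.refl Bool
  outputAlphabet := Equiv.refl Bool
  finiteAlphabets _ := inferInstanceAs (Finite Bool)
  ask := Label.test
  answer b v := (v.1, v.2 || b)
  accept v := v.2

/-- The step function `f` executes the label `l` without asking. -/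
def Executes (f : PopCfg → Option PopCfg) (asked : PopCfg → List (List Bool)) (l : Label) :
    Prop :=
  ∀ acc S, f ⟨some l, (none, acc), S⟩ = some (P.next l acc S) ∧
    asked ⟨some l, (none, acc), S⟩ = []

/-- Plain machines execute every label without asking, oracle machines every label but `test`.
Stated through `Executes`, the analysis of each phase serves both kinds. -/
theorem toFinTM2_executes (k₁ : Stack) (l : Label) :
    P.Executes (P.toFinTM2 k₁).step (fun _ => []) l := by
  intro acc S
  rw [← stepAux_stmt]
  exact ⟨rfl, rfl⟩

theorem toOracleTM_executes (O : Language Bool) {l : Label} (hl : l ≠ .test) :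
    P.Executes (P.toOracleTM.step O) P.toOracleTM.asked l := by
  intro acc S
  rw [← stepAux_stmt]
  exact ⟨if_neg hl, if_neg hl⟩

open Classical in
theorem toOracleTM_step_test (O : Language Bool) (acc : Bool) (S : Stack → List Bool) :
    P.toOracleTM.step O ⟨some Label.test, ((none, acc) : PopState), S⟩ =
      some (P.next .test (acc || decide (S .output ∈ O)) (update S .output [])) := by
  rw [← stepAux_stmt]
  refine (if_pos rfl).trans ?_
  have hq : P.toOracleTM.queryWord S = S .output := List.map_id _
  rw [hq]
  rfl

theorem toOracleTM_asked_test (acc : Bool) (S : Stack → List Bool) :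
    P.toOracleTM.asked ⟨some Label.test, ((none, acc) : PopState), S⟩ = [S .output] := by
  refine (if_pos rfl).trans ?_
  have hq : P.toOracleTM.queryWord S = S .output := List.map_id _
  rw [hq]

variable {P} {f : PopCfg → Option PopCfg} {asked : PopCfg → List (List Bool)}

theorem Executes.head {l : Label} (h : P.Executes f asked l) {n : ℕ} {acc : Bool}
    {S : Stack → List Bool} {c : PopCfg} {qs : List (List Bool)}
    (h' : ReachesIn f asked n (P.next l acc S) c qs) :
    ReachesIn f asked (n + 1) ⟨some l, (none, acc), S⟩ c qs :=
  .head (h acc S).1 (h acc S).2 h'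

end PopProgram

/-! ### The program -/

/-- The program of our machines.  The phase `scan` pushes the zeros of the input to `zeros` and,
if `keep`, the ones to `counter`, and goes on with `loop`.  The label `test` ends the loop in
`final` if no zeros are left, and else increments the counter and replaces `m + 1` zeros by `m / 2`
zeros.  The labels `copy₁` and `copy₂` copy the counter to the output stack, and the labels
`emit₀`, ..., `emit₄` write a circuit with as many disjunctions as indicated by the counter. -/
def logProgram (keep : Bool) (loop : Label) (final : Option Label) : PopProgram
  | .scan => (.input, fun
    | none => ([], some loop)
    | some true => (if keep then [(.counter, true)] else [], some .scan)
    | some false => ([(.zeros, false)], some .scan))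
  | .test => (.zeros, fun
    | none => ([], final)
    | some _ => ([(.counter, true)], some .halve₁))
  | .halve₁ => (.zeros, fun
    | none => ([], some .restore)
    | some _ => ([], some .halve₂))
  | .halve₂ => (.zeros, fun
    | none => ([], some .restore)
    | some _ => ([(.half, false)], some .halve₁))
  | .restore => (.half, fun
    | none => ([], some loop)
    | some _ => ([(.zeros, false)], some .restore))
  | .copy₁ => (.counter, fun
    | none => ([], some .copy₂)
    | some _ => ([(.spare, true)], some .copy₁))
  | .copy₂ => (.spare, fun
    | none => ([], some .test)
    | some _ => ([(.counter, true), (.output, true)], some .copy₂))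
  | .emit₀ => (.counter, fun
    | none => ([(.output, false), (.output, false), (.output, false)], none)
    | some _ => ([(.output, false), (.output, true)], some .emit₁))
  | .emit₁ => (.counter, fun
    | none => ([(.output, false)], some .emit₂)
    | some _ => ([(.output, true), (.output, true), (.spare, true)], some .emit₁))
  | .emit₂ => (.spare, fun
    | none => ([(.output, true), (.output, true), (.output, false), (.output, true)], some .emit₃)
    | some _ => ([(.output, true), (.output, true), (.counter, true)], some .emit₂))
  | .emit₃ => (.counter, fun
    | none => ([(.output, false), (.output, false)], some .emit₄)
    | some _ => ([(.output, true), (.spare, true)], some .emit₃))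
  | .emit₄ => (.spare, fun
    | none => ([], some .emit₀)
    | some _ => ([(.counter, true)], some .emit₄))

theorem replicate_append_cons {α : Type} (n : ℕ) (a : α) (l : List α) :
    List.replicate n a ++ a :: l = List.replicate (n + 1) a ++ l := by
  rw [List.replicate_succ', List.append_assoc]
  rfl

/-! ### Effect and running time of the phases. -/

namespace LogProgram

open PopProgram List

variable {keep : Bool} {loop : Label} {final : Option Label} {f : PopCfg → Option PopCfg}
  {asked : PopCfg → List (List Bool)}

/-- A configuration of our machines, with unary numbers on all stacks but the first two. -/
def cfg (l : Option Label) (acc : Bool) (i o : List Bool) (z h c s : ℕ) : PopCfg :=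
  ⟨l, (none, acc), contents i o (replicate z false) (replicate h false) (replicate c true)
    (replicate s true)⟩

theorem scan (h : Executes (logProgram keep loop final) f asked .scan)
    (acc : Bool) (x o : List Bool)
    (z n c s : ℕ) :
    ReachesIn f asked (x.length + 1) (cfg (some .scan) acc x o z n c s)
      (cfg (some loop) acc [] o (z + x.count false) n (bif keep then c + x.count true else c) s)
      [] := by
  induction x generalizing z c with
  | nil =>
    refine h.head ?_
    simp [PopProgram.next, logProgram, pushAll, contents, cfg]
    exact .refl _ _
  | cons b x ih =>
    refine h.head ?_
    cases b
    · have := ih (z + 1) c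
      rw [show z + 1 + x.count false = z + (x.count false + 1) by omega] at this
      simpa [PopProgram.next, logProgram, pushAll, contents, cfg, replicate_succ] using this
    · cases keep
      · have := ih z c
        simpa [PopProgram.next, logProgram, pushAll, contents, cfg] using this
      · have := ih z (c + 1)
        rw [show c + 1 + x.count true = c + (x.count true + 1) by omega] at this
        simpa [PopProgram.next, logProgram, pushAll, contents, cfg, replicate_succ] using this

theorem restore (h : Executes (logProgram keep loop final) f asked .restore)
    (acc : Bool) (i o : List Bool)
    (z n c s : ℕ) :
    ReachesIn f asked (n + 1) (cfg (some .restore) acc i o z n c s)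
      (cfg (some loop) acc i o (z + n) 0 c s) [] := by
  induction n generalizing z with
  | zero =>
    refine h.head ?_
    simp [PopProgram.next, logProgram, pushAll, contents, cfg]
    exact .refl _ _
  | succ n ih =>
    refine h.head ?_
    have := ih (z + 1)
    rw [show z + 1 + n = z + (n + 1) by omega] at this
    simpa [PopProgram.next, logProgram, pushAll, contents, cfg, replicate_succ] using this

theorem halve (h₁ : Executes (logProgram keep loop final) f asked .halve₁)
    (h₂ : Executes (logProgram keep loop final) f asked .halve₂) (acc : Bool) (i o : List Bool)
    (z n c s : ℕ) :
    ReachesIn f asked (z + 1) (cfg (some .halve₁) acc i o z n c s)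
      (cfg (some .restore) acc i o 0 (n + z / 2) c s) [] := by
  induction z using Nat.twoStepInduction generalizing n with
  | zero =>
    refine h₁.head ?_
    simp [PopProgram.next, logProgram, pushAll, contents, cfg]
    exact .refl _ _
  | one =>
    -- A last unpaired zero is popped by `halve₁` and then dropped by `halve₂`, which rounds the
    -- half down.
    refine h₁.head (n := 1) ?_
    simp [PopProgram.next, logProgram, pushAll, contents, cfg]
    refine h₂.head (n := 0) ?_
    simp [PopProgram.next, logProgram, pushAll, contents]
    exact .refl _ _
  | more z ih _ =>
    refine h₁.head ?_
    simp [PopProgram.next, logProgram, pushAll, contents, cfg, replicate_succ]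
    refine h₂.head ?_
    have := ih (n + 1)
    have hz : n + 1 + z / 2 = n + (z / 2 + 1) := by omega
    rw [hz] at this
    simpa [PopProgram.next, logProgram, pushAll, contents, cfg, replicate_succ] using this

theorem halve_restore (h₁ : Executes (logProgram keep loop final) f asked .halve₁)
    (h₂ : Executes (logProgram keep loop final) f asked .halve₂)
    (h₃ : Executes (logProgram keep loop final) f asked .restore)
    (acc : Bool) (i o : List Bool) (z c s : ℕ) :
    ReachesIn f asked (2 * z + 2) (cfg (some .halve₁) acc i o z 0 c s)
      (cfg (some loop) acc i o (z / 2) 0 c s) [] := by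
  have h := (halve h₁ h₂ acc i o z 0 c s).trans (restore h₃ acc i o 0 (0 + z / 2) c s)
  simp only [zero_add] at h
  exact h.mono (by omega)

theorem next_test_zero (acc : Bool) (i o : List Bool) (c s : ℕ) :
    (logProgram keep loop final).next .test acc (cfg none acc i o 0 0 c s).stk =
      cfg final acc i o 0 0 c s := by
  simp [PopProgram.next, logProgram, pushAll, contents, cfg]

theorem next_test_succ (acc : Bool) (i o : List Bool) (z c s : ℕ) :
    (logProgram keep loop final).next .test acc (cfg none acc i o (z + 1) 0 c s).stk =
      cfg (some .halve₁) acc i o z 0 (c + 1) s := by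
  simp [PopProgram.next, logProgram, pushAll, contents, cfg, replicate_succ]

/-- Replacing `z + 1` zeros by `z / 2` halves the number of zeros plus one, rounded down. Hence each
round of the loop lowers the logarithm by exactly one. -/
theorem log_step (z : ℕ) : Nat.log 2 (z + 1 + 1) = Nat.log 2 (z / 2 + 1) + 1 := by
  rw [Nat.log_of_one_lt_of_le one_lt_two (by omega)]
  congr 2
  omega

theorem copy₁ (h : Executes (logProgram keep loop final) f asked .copy₁)
    (acc : Bool) (i o : List Bool)
    (z n c s : ℕ) :
    ReachesIn f asked (c + 1) (cfg (some .copy₁) acc i o z n c s)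
      (cfg (some .copy₂) acc i o z n 0 (s + c)) [] := by
  induction c generalizing s with
  | zero =>
    refine h.head ?_
    simp [PopProgram.next, logProgram, pushAll, contents, cfg]
    exact .refl _ _
  | succ c ih =>
    refine h.head ?_
    have := ih (s + 1)
    rw [show s + 1 + c = s + (c + 1) by omega] at this
    simpa [PopProgram.next, logProgram, pushAll, contents, cfg, replicate_succ] using this

theorem copy₂ (h : Executes (logProgram keep loop final) f asked .copy₂)
    (acc : Bool) (i o : List Bool)
    (z n c s : ℕ) :
    ReachesIn f asked (s + 1) (cfg (some .copy₂) acc i o z n c s)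
      (cfg (some .test) acc i (replicate s true ++ o) z n (c + s) 0) [] := by
  induction s generalizing c o with
  | zero =>
    refine h.head ?_
    simp [PopProgram.next, logProgram, pushAll, contents, cfg]
    exact .refl _ _
  | succ s ih =>
    refine h.head ?_
    have := ih (true :: o) (c + 1)
    rw [replicate_append_cons, show c + 1 + s = c + (s + 1) by omega] at this
    simpa [PopProgram.next, logProgram, pushAll, contents, cfg, replicate_succ] using this

theorem copy (h₁ : Executes (logProgram keep loop final) f asked .copy₁)
    (h₂ : Executes (logProgram keep loop final) f asked .copy₂)
    (acc : Bool) (i : List Bool) (z n c : ℕ) :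
    ReachesIn f asked (2 * c + 2) (cfg (some .copy₁) acc i [] z n c 0)
      (cfg (some .test) acc i (replicate c true) z n c 0) [] := by
  have h := (copy₁ h₁ acc i [] z n c 0).trans (copy₂ h₂ acc i [] z n 0 (0 + c))
  simp only [zero_add, append_nil] at h
  exact h.mono (by omega)

/-! ### Computing the logarithm -/

theorem loop_test (h : ∀ l, Executes (logProgram keep .test final) f asked l)
    (acc : Bool) (i o : List Bool) (z c s : ℕ) :
    ReachesIn f asked (5 * z + 1) (cfg (some .test) acc i o z 0 c s)
      (cfg final acc i o 0 0 (c + Nat.log 2 (z + 1)) s) [] := by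
  induction z using Nat.strong_induction_on generalizing c with
  | _ z ih =>
    refine (h .test).head ?_
    cases z with
    | zero =>
      have := next_test_zero (keep := keep) (loop := .test) (final := final) acc i o c s
      simp only [cfg] at this ⊢
      rw [this]
      simpa using ReachesIn.refl _ _
    | succ z =>
      have := next_test_succ (keep := keep) (loop := .test) (final := final) acc i o z c s
      rw [cfg] at this
      dsimp only at this
      rw [this]
      have := (halve_restore (h _) (h _) (h _) acc i o z (c + 1) s).trans
        (ih (z / 2) (by omega) (c + 1))
      rw [add_assoc c, add_comm 1, ← log_step] at this
      exact this.mono (by omega)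

theorem run_test (h : ∀ l, Executes (logProgram keep .test final) f asked l)
    (x : List Bool) :
    ReachesIn f asked (6 * x.length + 2) (cfg (some .scan) false x [] 0 0 0 0)
      (cfg final false [] [] 0 0
        ((bif keep then x.count true else 0) + Nat.log 2 (x.count false + 1)) 0) [] := by
  have h' := (scan (h _) false x [] 0 0 0 0).trans (loop_test h false [] [] _ _ 0)
  simp only [zero_add] at h'
  refine h'.mono ?_
  have : x.count false ≤ x.length := count_le_length
  omega

/-! ### Asking the queries -/

open Classical in
theorem loop_copy (O : Language Bool) (acc : Bool) (z c : ℕ) :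
    ReachesIn ((logProgram true .copy₁ none).toOracleTM.step O)
      (logProgram true .copy₁ none).toOracleTM.asked ((z + 1) * (2 * c + 4 * z + 5))
      (cfg (some .copy₁) acc [] [] z 0 c 0)
      (cfg none (acc || (range' c (Nat.log 2 (z + 1) + 1)).any
          fun j => decide (replicate j true ∈ O))
        [] [] 0 0 (c + Nat.log 2 (z + 1)) 0)
      ((range' c (Nat.log 2 (z + 1) + 1)).map fun j => replicate j true) := by
  have hex : ∀ l ≠ Label.test, Executes (logProgram true .copy₁ none)
      ((logProgram true .copy₁ none).toOracleTM.step O)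
      (logProgram true .copy₁ none).toOracleTM.asked l :=
    fun l hl => toOracleTM_executes _ O hl
  induction z using Nat.strong_induction_on generalizing c acc with
  | _ z ih =>
    have hcopy := copy (hex .copy₁ (by decide)) (hex .copy₂ (by decide)) acc [] z 0 c
    have hstep := toOracleTM_step_test (logProgram true .copy₁ none) O acc
      (cfg none acc [] (replicate c true) z 0 c 0).stk
    have hask := toOracleTM_asked_test (logProgram true .copy₁ none) acc
      (cfg none acc [] (replicate c true) z 0 c 0).stk
    have hout : (cfg none acc [] (replicate c true) z 0 c 0).stk .output = replicate c true := rfl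
    have hupd : update (cfg none acc [] (replicate c true) z 0 c 0).stk .output [] =
        (cfg none (acc || decide (replicate c true ∈ O)) [] [] z 0 c 0).stk :=
      update_contents_output ..
    rw [hout, hupd] at hstep
    rw [hout] at hask
    -- The current round asks `1^c`; the remaining queries come from the induction hypothesis with
    -- counter `c + 1`.
    rw [range'_succ, any_cons, map_cons, ← Bool.or_assoc]
    cases z with
    | zero =>
      replace hstep := hstep.trans (congrArg some (next_test_zero ..))
      have := hcopy.trans (ReachesIn.head hstep hask (ReachesIn.refl 0 _))
      simp only [zero_add, Nat.log_one_right, range'_zero, any_nil, Bool.or_false, map_nil,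
        add_zero]
      exact this.mono (by omega)
    | succ z =>
      replace hstep := hstep.trans (congrArg some (next_test_succ ..))
      have hhalve := halve_restore (hex .halve₁ (by decide)) (hex .halve₂ (by decide))
        (hex .restore (by decide)) (acc || decide (replicate c true ∈ O)) [] [] z (c + 1) 0
      have := hcopy.trans (ReachesIn.head hstep hask
        (hhalve.trans (ih (z / 2) (by omega) (acc || decide (replicate c true ∈ O)) (c + 1))))
      rw [← log_step, add_assoc c, add_comm 1, ← log_step] at this
      refine this.mono ?_
      have : z / 2 ≤ z := Nat.div_le_self z 2
      have h3 : (z / 2 + 1) * (2 * (c + 1) + 4 * (z / 2) + 5) ≤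
          (z + 1) * (2 * c + 4 * z + 7) := Nat.mul_le_mul (by omega) (by omega)
      nlinarith

/-! ### Writing the circuit -/

/-- A circuit that computes the disjunction of `n + 1` inputs. -/
def orCircuit : ℕ → Circuit
  | 0 => [.input 0]
  | n + 1 => orCircuit n ++ [.input (n + 1), .or (2 * n) (2 * n + 1)]

theorem emit₁ (h : Executes (logProgram keep loop final) f asked .emit₁)
    (acc : Bool) (i o : List Bool)
    (z n c s : ℕ) :
    ReachesIn f asked (c + 1) (cfg (some .emit₁) acc i o z n c s)
      (cfg (some .emit₂) acc i (false :: (replicate (2 * c) true ++ o)) z n 0 (s + c)) [] := by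
  induction c generalizing s o with
  | zero =>
    refine h.head ?_
    simp [PopProgram.next, logProgram, pushAll, contents, cfg]
    exact .refl _ _
  | succ c ih =>
    refine h.head ?_
    have := ih (true :: true :: o) (s + 1)
    rw [replicate_append_cons, replicate_append_cons,
      show s + 1 + c = s + (c + 1) by omega,
      show 2 * c + 1 + 1 = 2 * (c + 1) by omega] at this
    simpa [PopProgram.next, logProgram, pushAll, contents, cfg, replicate_succ] using this

theorem emit₂ (h : Executes (logProgram keep loop final) f asked .emit₂)
    (acc : Bool) (i o : List Bool)
    (z n c s : ℕ) :
    ReachesIn f asked (s + 1) (cfg (some .emit₂) acc i o z n c s)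
      (cfg (some .emit₃) acc i
        (true :: false :: true :: true :: (replicate (2 * s) true ++ o)) z n (c + s) 0) [] := by
  induction s generalizing c o with
  | zero =>
    refine h.head ?_
    simp [PopProgram.next, logProgram, pushAll, contents, cfg]
    exact .refl _ _
  | succ s ih =>
    refine h.head ?_
    have := ih (true :: true :: o) (c + 1)
    rw [replicate_append_cons, replicate_append_cons,
      show c + 1 + s = c + (s + 1) by omega,
      show 2 * s + 1 + 1 = 2 * (s + 1) by omega] at this
    simpa [PopProgram.next, logProgram, pushAll, contents, cfg, replicate_succ] using this

theorem emit₃ (h : Executes (logProgram keep loop final) f asked .emit₃)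
    (acc : Bool) (i o : List Bool)
    (z n c s : ℕ) :
    ReachesIn f asked (c + 1) (cfg (some .emit₃) acc i o z n c s)
      (cfg (some .emit₄) acc i (false :: false :: (replicate c true ++ o)) z n 0 (s + c)) [] := by
  induction c generalizing s o with
  | zero =>
    refine h.head ?_
    simp [PopProgram.next, logProgram, pushAll, contents, cfg]
    exact .refl _ _
  | succ c ih =>
    refine h.head ?_
    have := ih (true :: o) (s + 1)
    rw [replicate_append_cons, show s + 1 + c = s + (c + 1) by omega] at this
    simpa [PopProgram.next, logProgram, pushAll, contents, cfg, replicate_succ] using this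

theorem emit₄ (h : Executes (logProgram keep loop final) f asked .emit₄)
    (acc : Bool) (i o : List Bool)
    (z n c s : ℕ) :
    ReachesIn f asked (s + 1) (cfg (some .emit₄) acc i o z n c s)
      (cfg (some .emit₀) acc i o z n (c + s) 0) [] := by
  induction s generalizing c with
  | zero =>
    refine h.head ?_
    simp [PopProgram.next, logProgram, pushAll, contents, cfg]
    exact .refl _ _
  | succ s ih =>
    refine h.head ?_
    have := ih (c + 1)
    rw [show c + 1 + s = c + (s + 1) by omega] at this
    simpa [PopProgram.next, logProgram, pushAll, contents, cfg, replicate_succ] using this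

/-- The output stack grows at its top, so the code is written from its end. Read from right to left,
the blocks are what one round from `emit₀` to `emit₃` pushes; the odd `true` in an index accounts
for the `+ 1` in `2 * n + 1` and `n + 1`. -/
theorem encode_orCircuit_succ (n : ℕ) (o : List Bool) :
    (orCircuit (n + 1)).encode ++ o = (orCircuit n).encode ++
      (false :: false :: (replicate n true ++ true :: false :: true :: true ::
        (replicate (2 * n) true ++ false :: (replicate (2 * n) true ++ true :: false :: o)))) := by
  simp only [replicate_append_cons, orCircuit, Circuit.encode, flatMap_append, flatMap_cons,
    flatMap_nil, Gate.encode, Gate.encodeIndex, append_assoc, cons_append, nil_append]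

theorem emit (h : ∀ l, Executes (logProgram keep loop final) f asked l)
    (acc : Bool) (i o : List Bool)
    (z m n : ℕ) :
    ReachesIn f asked (4 * n ^ 2 + n + 1) (cfg (some .emit₀) acc i o z m n 0)
      (cfg none acc i ((orCircuit n).encode ++ o) z m 0 0) [] := by
  induction n generalizing o with
  | zero =>
    refine (h .emit₀).head ?_
    simp [PopProgram.next, logProgram, pushAll, contents, cfg, orCircuit, Circuit.encode,
      Gate.encode, Gate.encodeIndex]
    exact .refl _ _
  | succ n ih =>
    have h1 := emit₁ (h _) acc i (true :: false :: o) z m n 0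
    have h2 := h1.trans (emit₂ (h _) acc i _ z m 0 _)
    have h3 := h2.trans (emit₃ (h _) acc i _ z m _ 0)
    have h4 := h3.trans (emit₄ (h _) acc i _ z m 0 _)
    simp only [zero_add] at h4
    have h5 := h4.trans (ih _)
    rw [← encode_orCircuit_succ] at h5
    have h6 : ReachesIn f asked _ (cfg (some .emit₀) acc i o z m (n + 1) 0) _ _ :=
      (h .emit₀).head (by
        simpa [PopProgram.next, logProgram, pushAll, contents, cfg, replicate_succ] using h5)
    exact h6.mono (by nlinarith)

end LogProgram

/-! ### From programs to functions computable in polynomial time. -/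

theorem Turing.haltList_stk (tm : Turing.FinTM2) (s : List (tm.Γ tm.k₁)) :
    (Turing.haltList tm s).stk = update (fun _ => []) tm.k₁ s := by
  funext k
  by_cases h : k = tm.k₁
  · subst h
    simp [Turing.haltList]
  · simp [Turing.haltList, h]

namespace PopProgram

theorem initList_toFinTM2 (P : PopProgram) (k₁ : Stack) (x : List Bool) :
    Turing.initList (P.toFinTM2 k₁) x = LogProgram.cfg (some .scan) false x [] 0 0 0 0 := by
  have h : update (fun _ => []) Stack.input x = contents x [] [] [] [] [] := by
    rw [← contents_nil, update_contents_input]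
  exact congrArg (fun S => (⟨some .scan, (none, false), S⟩ : PopCfg))
    ((Turing.initList_stk (P.toFinTM2 k₁) x).trans h)

/-- A program that halts with its output on the stack `k₁` and the other stacks empty, in a number
of steps bounded by a polynomial, computes a function. -/
theorem computableInPolyTime (P : PopProgram) (k₁ : Stack) {β : Type} (enc : β → List Bool)
    (g : List Bool → β) (time : Polynomial ℕ) (out : List Bool → Stack → List Bool)
    (hout : ∀ x, update (fun _ => []) k₁ (enc (g x)) = out x)
    (h : ∀ x, ReachesIn (P.toFinTM2 k₁).step (fun _ => ([] : List (List Bool)))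
      (time.eval x.length) (LogProgram.cfg (some .scan) false x [] 0 0 0 0)
      ⟨none, ((none, false) : PopState), out x⟩ []) :
    Nonempty (Turing.TM2ComputableInPolyTime (id : List Bool → List Bool) enc g) := by
  refine ⟨⟨⟨P.toFinTM2 k₁, Equiv.refl Bool, Equiv.refl Bool⟩, time, fun x => ?_⟩⟩
  have hinit : Turing.initList (P.toFinTM2 k₁) (x.map (Equiv.refl Bool).invFun) =
      LogProgram.cfg (some .scan) false x [] 0 0 0 0 :=
    (congrArg (Turing.initList (P.toFinTM2 k₁)) (List.map_id x)).trans
      (initList_toFinTM2 P k₁ x)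
  have hstk : (Turing.haltList (P.toFinTM2 k₁) (enc (g x))).stk = out x :=
    (Turing.haltList_stk _ _).trans (hout x)
  -- The prescribed halting configuration has the initial internal state, which is why `h` fixes the
  -- final state to `(none, false)`.
  have hhalt : Turing.haltList (P.toFinTM2 k₁) ((enc (g x)).map (Equiv.refl Bool).invFun) =
      ⟨none, ((none, false) : PopState), out x⟩ :=
    (congrArg (Turing.haltList (P.toFinTM2 k₁)) (List.map_id _)).trans
      (congrArg (fun S => (⟨none, (none, false), S⟩ : PopCfg)) hstk)
  exact cast (congrArg₂ (fun a b => StateTransition.EvalsToInTime (P.toFinTM2 k₁).step a (some b)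
    (time.eval x.length)) hinit.symm hhalt.symm) (Classical.choice (h x).evalsToInTime)

end PopProgram

open LogProgram

theorem isParameterization_logParam : IsParameterization logParam := by
  refine ⟨logParam_le_length, ?_⟩
  refine (logProgram true .test none).computableInPolyTime .counter _ _
    (6 * Polynomial.X + 2) (fun x => contents [] [] [] [] (List.replicate (logParam x) true) [])
    (fun x => ?_) fun x => ?_
  · have henc : ∀ n, Computability.unaryEncodeNat n = List.replicate n true := by
      intro n
      induction n with
      | zero => rfl
      | succ n ih => rw [Computability.unaryEncodeNat, ih, List.replicate_succ]
    rw [henc, ← contents_nil, update_contents_counter]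
  · exact (run_test ((logProgram true .test none).toFinTM2_executes .counter) x).mono (by simp)

/-- The disjunction circuit for the queries asked on input `x`. -/
def windowCircuit (x : List Bool) : Circuit := orCircuit (Nat.log 2 (x.count false + 1))

theorem computable_windowCircuit :
    Nonempty (Turing.TM2ComputableInPolyTime (id : List Bool → List Bool) Circuit.encode
      windowCircuit) := by
  refine (logProgram false .test (some .emit₀)).computableInPolyTime .output _ _
    -- The sum of the bounds in `run_test` and `emit`, as the logarithm is at most the input length.
    (4 * Polynomial.X ^ 2 + 7 * Polynomial.X + 3)
    (fun x => contents [] (windowCircuit x).encode [] [] [] []) (fun x => ?_) fun x => ?_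
  · rw [← contents_nil, update_contents_output]
  · have hex := (logProgram false .test (some .emit₀)).toFinTM2_executes .output
    have h := (run_test hex x).trans (emit hex false [] [] 0 0 _)
    simp only [cond_false, zero_add, List.append_nil] at h
    refine h.mono ?_
    have h1 : Nat.log 2 (x.count false + 1) ≤ x.length :=
      (log_two_succ_le _).trans List.count_le_length
    simp only [Polynomial.eval_add, Polynomial.eval_mul, Polynomial.eval_pow, Polynomial.eval_X,
      Polynomial.eval_ofNat]
    nlinarith

/-! ### The circuit -/

theorem length_orCircuit (n : ℕ) : (orCircuit n).length = 2 * n + 1 := by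
  induction n with
  | zero => rfl
  | succ n ih =>
    rw [orCircuit, List.length_append, ih]
    rfl

theorem Gate.WF.mono {n n' m m' : ℕ} {g : Gate} (h : g.WF n m) (hn : n ≤ n') (hm : m ≤ m') :
    g.WF n' m' := by
  cases g <;> simp only [Gate.WF] at h ⊢ <;> omega

theorem orCircuit_wf (n : ℕ) : (orCircuit n).WF (n + 1) := by
  refine ⟨?_, ?_⟩
  · rw [← List.length_pos_iff, length_orCircuit]
    omega
  · induction n with
    | zero =>
      intro m g hg
      rcases m with _ | m
      · obtain rfl : Gate.input 0 = g := by simpa [orCircuit] using hg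
        simp [Gate.WF]
      · simp [orCircuit] at hg
    | succ n ih =>
      intro m g hg
      rw [orCircuit] at hg
      rcases lt_or_ge m (2 * n + 1) with hm | hm
      · rw [List.getElem?_append_left (by rwa [length_orCircuit])] at hg
        exact (ih m g hg).mono (Nat.le_succ _) le_rfl
      · rw [List.getElem?_append_right (by rwa [length_orCircuit]), length_orCircuit] at hg
        obtain ⟨d, rfl⟩ := Nat.exists_eq_add_of_le hm
        rw [Nat.add_sub_cancel_left] at hg
        rcases d with _ | _ | d
        · obtain rfl : Gate.input (n + 1) = g := by simpa using hg
          simp [Gate.WF]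
        · obtain rfl : Gate.or (2 * n) (2 * n + 1) = g := by simpa using hg
          simp only [Gate.WF]
          omega
        · simp at hg

theorem values_append (a : List Bool) (C C' : Circuit) :
    Circuit.values a (C ++ C') = C'.foldl (fun w g => w ++ [g.eval a w]) (C.values a) :=
  List.foldl_append ..

/-- The length of `w` places the partial disjunction at position `2 * n`, where the next `or` gate
looks for it; the next input bit follows at `2 * n + 1`. -/
theorem values_orCircuit (a : List Bool) (n : ℕ) (hn : n < a.length) :
    ∃ w, (orCircuit n).values a = w ++ [(a.take (n + 1)).any id] ∧ w.length = 2 * n := by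
  induction n with
  | zero =>
    refine ⟨[], ?_, rfl⟩
    obtain _ | ⟨b, a⟩ := a
    · simp at hn
    · simp [orCircuit, Circuit.values, Gate.eval]
  | succ n ih =>
    obtain ⟨w, hw, hlen⟩ := ih (by omega)
    refine ⟨w ++ [(a.take (n + 1)).any id, a.getD (n + 1) false], ?_, by simp [hlen]; omega⟩
    rw [orCircuit, values_append, hw, List.take_succ_eq_append_getElem hn, List.any_append]
    simp [Gate.eval, ← hlen, List.getD, hn]

theorem eval_orCircuit (a : List Bool) (n : ℕ) (hn : a.length = n + 1) :
    (orCircuit n).eval a = a.any id := by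
  obtain ⟨w, hw, -⟩ := values_orCircuit a n (by omega)
  rw [Circuit.eval, hw, ← hn, List.take_length]
  simp

/-! ### The kernelization -/

/-- The oracle machine that asks for the membership of all `replicate j true` with `j` between
the number of ones in the input and the parameter. -/
def windowMachine : OracleTM := (logProgram true .copy₁ none).toOracleTM

/-- The queries of `windowMachine`. -/
def windowQueries (x : List Bool) : List (List Bool) :=
  (List.range' (x.count true) (Nat.log 2 (x.count false + 1) + 1)).map
    fun j => List.replicate j true

theorem length_windowQueries (x : List Bool) :
    (windowQueries x).length = Nat.log 2 (x.count false + 1) + 1 := by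
  simp [windowQueries]

theorem mem_windowQueries {x q : List Bool} : q ∈ windowQueries x ↔
    ∃ j, x.count true ≤ j ∧ j ≤ logParam x ∧ List.replicate j true = q := by
  simp only [windowQueries, logParam, List.mem_map, List.mem_range'_1, and_assoc]
  refine exists_congr fun j => and_congr_right fun _ => and_congr_left fun _ => ?_
  omega

/-- A word without zeros has a one-point window, so such queries read `A` bit by bit. -/
theorem replicate_mem_windowLanguage {A : ℕ → Bool} {j : ℕ} :
    List.replicate j true ∈ windowLanguage A ↔ A j = true := by
  have h : logParam (List.replicate j true) = j := by simp [logParam, List.count_replicate]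
  rw [mem_windowLanguage, h, List.count_replicate_self]
  exact ⟨fun ⟨i, h1, h2, h3⟩ => le_antisymm h2 h1 ▸ h3, fun h => ⟨j, le_rfl, le_rfl, h⟩⟩

/-- A bound for the running time of `windowMachine`. -/
noncomputable def windowTime : Polynomial ℕ :=
  (Polynomial.X + 1) * (6 * Polynomial.X + 6)

open Classical in
theorem haltsWith_windowMachine (O : Language Bool) (x : List Bool) :
    windowMachine.HaltsWith O x (windowTime.eval x.length)
      ((windowQueries x).any fun q => decide (q ∈ O)) (windowQueries x) := by
  have hscan := scan (keep := true) (loop := .copy₁) (final := none)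
    (PopProgram.toOracleTM_executes _ O (by decide)) false x [] 0 0 0 0
  have h := hscan.trans (loop_copy O false _ _)
  simp only [zero_add, cond_true, Bool.false_or, List.nil_append] at h
  have hinit : windowMachine.init x = cfg (some .scan) false x [] 0 0 0 0 := by
    rw [← PopProgram.initList_toFinTM2 (logProgram true .copy₁ none) .output, OracleTM.init]
    exact congrArg (Turing.initList ((logProgram true .copy₁ none).toFinTM2 .output))
      (List.map_id x)
  have htime : x.length + 1 + (x.count false + 1) * (2 * x.count true + 4 * x.count false + 5) ≤
      windowTime.eval x.length := by
    have h1 := List.count_true_add_count_false x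
    simp only [windowTime, Polynomial.eval_add, Polynomial.eval_mul, Polynomial.eval_X,
      Polynomial.eval_ofNat, Polynomial.eval_one]
    have h2 : (x.count false + 1) * (2 * x.count true + 4 * x.count false + 5) ≤
      (x.length + 1) * (6 * x.length + 5) := Nat.mul_le_mul (by omega) (by omega)
    nlinarith
  have hrun := OracleTM.run_of_reachesIn (M := windowMachine) (h.mono htime) rfl
  rw [OracleTM.HaltsWith, hinit, hrun]
  refine ⟨rfl, ?_, rfl⟩
  rw [windowQueries, List.any_map]
  rfl

theorem isPsizeKernelization_windowMachine (A : ℕ → Bool) :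
    IsPsizeKernelization (windowLanguage A) logParam windowMachine := by
  classical
  -- Queries `1^j` have `j ≤ logParam x`, hence the size bound `X`. A window has at most `logParam x
  -- + 1` elements, and the disjunction of `n + 1` bits takes `2 * n + 1` gates.
  refine ⟨⟨⟨windowTime, Polynomial.X, fun x => ⟨_, _, haltsWith_windowMachine _ x, ?_, ?_⟩⟩,
    windowTime, fun x => ⟨windowQueries x, fun O => ⟨_, haltsWith_windowMachine O x⟩⟩⟩,
    ⟨Polynomial.X + 1, fun x t b qs h => ?_⟩,
    windowCircuit, 2 * Polynomial.X + 1, computable_windowCircuit, fun x => ⟨?_, ?_⟩⟩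
  · rw [List.any_eq_true, mem_windowLanguage]
    constructor
    · rintro ⟨q, hq, hqX⟩
      obtain ⟨j, h1, h2, rfl⟩ := mem_windowQueries.1 hq
      exact ⟨j, h1, h2, replicate_mem_windowLanguage.1 (of_decide_eq_true hqX)⟩
    · rintro ⟨j, h1, h2, h3⟩
      exact ⟨_, mem_windowQueries.2 ⟨j, h1, h2, rfl⟩,
        decide_eq_true (replicate_mem_windowLanguage.2 h3)⟩
  · intro q hq
    obtain ⟨j, h1, h2, rfl⟩ := mem_windowQueries.1 hq
    simpa using h2
  · obtain ⟨-, rfl⟩ := h.unique (haltsWith_windowMachine _ x)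
    rw [length_windowQueries]
    simp [logParam]
  · rw [windowCircuit, length_orCircuit]
    simp only [Polynomial.eval_add, Polynomial.eval_mul, Polynomial.eval_X,
      Polynomial.eval_ofNat, Polynomial.eval_one, logParam]
    omega
  · intro O t b qs h
    obtain ⟨rfl, rfl⟩ := h.unique (haltsWith_windowMachine O x)
    refine ⟨?_, ?_⟩
    · rw [length_windowQueries]
      exact orCircuit_wf _
    · rw [windowCircuit, eval_orCircuit _ _ (by rw [List.length_map, length_windowQueries]),
        List.any_map]
      rfl

theorem theorem3 :
    ∃ (X : Language Bool) (κ : List Bool → ℕ), IsParameterization κ ∧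
      (∃ M : OracleTM, IsPsizeKernelization X κ M) ∧
      ¬ ∃ (M : OracleTM) (c : ℕ),
        IsPolyTuringKernelization X κ M ∧ ∀ x, M.AsksAtMost X x c := by
  obtain ⟨A, hA⟩ := exists_not_constant_query_kernelization
  exact ⟨windowLanguage A, logParam, isParameterization_logParam,
    ⟨windowMachine, isPsizeKernelization_windowMachine A⟩, hA⟩
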